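/- Let $X$ be a finite set. A pair $(\mathcal A,\mathcal B)$ of families of subsets of $X$ is called a \emph{recovering pair} over $X$ if for all $A,A'\in\mathcal A$ and $B,B'\in\mathcal B$, $$A\setminus B=A'\setminus B'\implies A=A',\qquad B\setminus A=B'\setminus A'\implies B=B',$$ and a \emph{cancellative pair} over $X$ if for all $A,A'\in\mathcal A$ and $B,B'\in\mathcal B$, $$A\setminus B=A'\setminus B\implies A=A',\qquad B\setminus A=B'\setminus A\implies B=B'.$$ Put $$\mu_{\mathrm{rec}}=\lim_{n\to\infty}\max\{(|\mathcal A||\mathcal B|)^{1/n}:(\mathcal A,\mathcal B)\text{ is a recovering pair over }[n]\},$$ $$\mu_{\mathrm{can}}=\lim_{n\to\infty}\max\{(|\mathcal A||\mathcal B|)^{1/n}:(\mathcal A,\mathcal B)\text{ is a cancellative pair over }[n]\}.$$ Then both limits exist, and with $\alpha=0.27$ and $\theta=2.222$, every recovering pair $(\mathcal A,\mathcal B)$ over a set of $n$ elements satisfies $$|\mathcal A||\mathcal B|\le\max\{2.2499,\ \theta^{\alpha}\,\mu_{\mathrm{can}}^{1-\alpha}\}^n.$$ In particular, $\mu_{\mathrm{rec}}<\mu_{\mathrm{can}}$.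 -/

import Mathlib

/-- `(A, B)` is a recovering pair over `X`. -/
def IsRecoveringPair {X : Type*} [DecidableEq X] (A B : Finset (Finset X)) : Prop :=
  ∀ S ∈ A, ∀ S' ∈ A, ∀ T ∈ B, ∀ T' ∈ B,
    (S \ T = S' \ T' → S = S') ∧ (T \ S = T' \ S' → T = T')

/-- `(A, B)` is a cancellative pair over `X`. -/
def IsCancellativePair {X : Type*} [DecidableEq X] (A B : Finset (Finset X)) : Prop :=
  ∀ S ∈ A, ∀ S' ∈ A, ∀ T ∈ B, ∀ T' ∈ B,
    (S \ T = S' \ T → S = S') ∧ (T \ S = T' \ S → T = T')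

/-- The values `(|A||B|)^(1/n)` over all recovering pairs `(A, B)` over an `n`-element set. -/
def recValues (n : ℕ) : Set ℝ :=
  {r | ∃ A B : Finset (Finset (Fin n)), IsRecoveringPair A B ∧
    r = ((A.card : ℝ) * (B.card : ℝ)) ^ (1 / (n : ℝ))}

/-- The values `(|A||B|)^(1/n)` over all cancellative pairs `(A, B)` over an `n`-element set. -/
def canValues (n : ℕ) : Set ℝ :=
  {r | ∃ A B : Finset (Finset (Fin n)), IsCancellativePair A B ∧
    r = ((A.card : ℝ) * (B.card : ℝ)) ^ (1 / (n : ℝ))}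

/-- The maximum of `(|A||B|)^(1/n)` over recovering pairs; see `isGreatest_maxRec`. -/
noncomputable def maxRec (n : ℕ) : ℝ := sSup (recValues n)

/-- The maximum of `(|A||B|)^(1/n)` over cancellative pairs; see `isGreatest_maxCan`. -/
noncomputable def maxCan (n : ℕ) : ℝ := sSup (canValues n)

/-- The optimal rate for recovering pairs. -/
noncomputable def muRec : ℝ := Filter.limUnder Filter.atTop maxRec

/-- The optimal rate for cancellative pairs. -/
noncomputable def muCan : ℝ := Filter.limUnder Filter.atTop maxCan

theorem isGreatest_maxRec (n : ℕ) : IsGreatest (recValues n) (maxRec n) := by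
  have hfin : (recValues n).Finite :=
    (Set.finite_range fun p : Finset (Finset (Fin n)) × Finset (Finset (Fin n)) =>
      ((p.1.card : ℝ) * (p.2.card : ℝ)) ^ (1 / (n : ℝ))).subset
      (by rintro r ⟨A, B, -, rfl⟩; exact ⟨(A, B), rfl⟩)
  have hne : (recValues n).Nonempty := ⟨_, ∅, ∅, by simp [IsRecoveringPair], rfl⟩
  exact ⟨hne.csSup_mem hfin, fun r hr => le_csSup hfin.bddAbove hr⟩

theorem isGreatest_maxCan (n : ℕ) : IsGreatest (canValues n) (maxCan n) := by
  have hfin : (canValues n).Finite :=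
    (Set.finite_range fun p : Finset (Finset (Fin n)) × Finset (Finset (Fin n)) =>
      ((p.1.card : ℝ) * (p.2.card : ℝ)) ^ (1 / (n : ℝ))).subset
      (by rintro r ⟨A, B, -, rfl⟩; exact ⟨(A, B), rfl⟩)
  have hne : (canValues n).Nonempty := ⟨_, ∅, ∅, by simp [IsCancellativePair], rfl⟩
  exact ⟨hne.csSup_mem hfin, fun r hr => le_csSup hfin.bddAbove hr⟩

/-!
Let `(A, B)` be a recovering pair and `S ∈ A`, `T ∈ B` independent and uniformly random. As `S \ T`
determines `S`, for every set `Y` the entropy of `(S \ T, T ∩ Y)` equals the entropy of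
`(S, T ∩ (S ∪ Y))`. The left side is bounded coordinate by coordinate, and the right side is
`log |A|` plus the mean over `S` of the entropy of the trace of `B` on `S ∪ Y`. Trace entropy is
submodular, so the greedy algorithm yields an additive minorant of it that is tight on every
superlevel set of prescribed weights on the coordinates. Taking `Y` to be a uniformly random
superlevel set bounds `log |A| + κ log |B|` by a sum over coordinates of functions of their
densities in `A` and `B`. Adding the bound with `A` and `B` exchanged, at `κ = 3/10`, leaves an
inequality in two real variables, verified by subdividing the unit square; it gives
`|A||B| ≤ 2.2499 ^ n`.

On the other hand `μ_can ≥ 9/4` by a construction of Tolhuizen: take the `k`-subsets of `[n]` that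
index linearly independent columns with a prescribed sum in a random `(k + 1) × n` matrix over `𝔽₂`.
About `C(n, k) / 2 ^ k` of them remain, which is `(3/2) ^ n` up to a polynomial factor for the
best `k`.
-/

section Entropy

open Finset

variable {α β γ δ : Type*} [DecidableEq β] [DecidableEq γ] [DecidableEq δ]

/-- Shannon entropy, in nats, of `f x` for a uniformly random `x ∈ Ω`. -/
noncomputable def unifEntropy (Ω : Finset α) (f : α → β) : ℝ :=
  (∑ x ∈ Ω, Real.log (#Ω / #{y ∈ Ω | f y = f x})) / #Ω

/-- Conditional entropy of `f x` given `k x`, for a uniformly random `x ∈ Ω`. -/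
noncomputable def unifCondEntropy (Ω : Finset α) (f : α → β) (k : α → γ) : ℝ :=
  unifEntropy Ω (fun x => (f x, k x)) - unifEntropy Ω k

theorem card_fiber_pos {Ω : Finset α} (f : α → β) {x : α} (hx : x ∈ Ω) :
    (0 : ℝ) < #{y ∈ Ω | f y = f x} :=
  mod_cast card_pos.2 ⟨x, mem_filter.2 ⟨hx, rfl⟩⟩

theorem card_mul_unifEntropy (Ω : Finset α) (f : α → β) :
    #Ω * unifEntropy Ω f = ∑ x ∈ Ω, Real.log (#Ω / #{y ∈ Ω | f y = f x}) := by
  rcases Ω.eq_empty_or_nonempty with rfl | hΩ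
  · simp
  · exact mul_div_cancel₀ _ (by exact_mod_cast hΩ.card_ne_zero)

theorem unifEntropy_congr {Ω : Finset α} {f : α → β} {g : α → γ}
    (h : ∀ x ∈ Ω, ∀ y ∈ Ω, f x = f y ↔ g x = g y) : unifEntropy Ω f = unifEntropy Ω g := by
  simp only [unifEntropy]
  congr 1
  refine sum_congr rfl fun x hx => ?_
  rw [filter_congr fun y hy => h y hy x hx]

theorem unifEntropy_const (Ω : Finset α) (c : β) : unifEntropy Ω (fun _ => c) = 0 := by
  rcases Ω.eq_empty_or_nonempty with rfl | hΩ
  · simp [unifEntropy]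
  · simp [unifEntropy, div_self (Nat.cast_ne_zero.2 hΩ.card_ne_zero : (#Ω : ℝ) ≠ 0)]

theorem unifEntropy_of_injective (Ω : Finset α) {f : α → β} (hf : f.Injective) :
    unifEntropy Ω f = Real.log #Ω := by
  classical
  rcases Ω.eq_empty_or_nonempty with rfl | hΩ
  · simp [unifEntropy]
  have hc : (#Ω : ℝ) ≠ 0 := by exact_mod_cast hΩ.card_ne_zero
  have hfiber : ∀ x ∈ Ω, Real.log (#Ω / #{y ∈ Ω | f y = f x}) = Real.log #Ω := by
    intro x hx
    have hsingle : {y ∈ Ω | f y = f x} = {x} := by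
      ext y
      simp only [mem_filter, hf.eq_iff, mem_singleton]
      exact ⟨And.right, fun h => ⟨h ▸ hx, h⟩⟩
    rw [hsingle, card_singleton, Nat.cast_one, div_one]
  rw [unifEntropy, sum_congr rfl hfiber, sum_const, nsmul_eq_mul, mul_div_cancel_left₀ _ hc]

theorem unifEntropy_map {ι : Type*} (e : α ↪ ι) (Ω : Finset α) (f : ι → β) :
    unifEntropy (Ω.map e) f = unifEntropy Ω (f ∘ e) := by
  simp only [unifEntropy, card_map, sum_map, filter_map, Function.comp_def]

theorem sum_div_card_fiber (Ω : Finset α) (f : α → β) (r : β → ℝ) :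
    ∑ x ∈ Ω, r (f x) / #{y ∈ Ω | f y = f x} = ∑ b ∈ Ω.image f, r b := by
  rw [← sum_fiberwise_of_maps_to (g := f) (t := Ω.image f) fun x => mem_image_of_mem f]
  refine sum_congr rfl fun b hb => ?_
  obtain ⟨x, hx, rfl⟩ := mem_image.1 hb
  calc ∑ y ∈ Ω with f y = f x, r (f y) / #{z ∈ Ω | f z = f y}
      = ∑ y ∈ Ω with f y = f x, r (f x) / #{z ∈ Ω | f z = f x} :=
        sum_congr rfl fun y hy => by rw [(mem_filter.1 hy).2]
    _ = r (f x) := by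
        rw [sum_const, nsmul_eq_mul, mul_div_cancel₀ _ (card_fiber_pos f hx).ne']

theorem sum_card_fiber (Ω : Finset α) (f : α → β) :
    ∑ b ∈ Ω.image f, (#{y ∈ Ω | f y = b} : ℝ) = #Ω :=
  mod_cast (card_eq_sum_card_image f Ω).symm

theorem unifEntropy_prodMk_le (Ω : Finset α) (f : α → β) (g : α → γ) :
    unifEntropy Ω (fun x => (f x, g x)) ≤ unifEntropy Ω f + unifEntropy Ω g := by
  rcases Ω.eq_empty_or_nonempty with rfl | hΩ
  · simp [unifEntropy]
  have hc : (0 : ℝ) < #Ω := by exact_mod_cast hΩ.card_pos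
  set w : β × γ → ℝ := fun z => #{y ∈ Ω | f y = z.1} * #{y ∈ Ω | g y = z.2} with hw
  have hlog : ∀ x ∈ Ω, Real.log (#Ω / #{y ∈ Ω | (f y, g y) = (f x, g x)}) ≤
      Real.log (#Ω / #{y ∈ Ω | f y = f x}) + Real.log (#Ω / #{y ∈ Ω | g y = g x}) +
        (w (f x, g x) / #{y ∈ Ω | (f y, g y) = (f x, g x)} / #Ω - 1) := by
    intro x hx
    have hf := card_fiber_pos f hx
    have hg := card_fiber_pos g hx
    have hfg := card_fiber_pos (fun x => (f x, g x)) hx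
    have h := Real.log_le_sub_one_of_pos
      (div_pos (div_pos (mul_pos hf hg) hfg) hc)
    rw [Real.log_div (by positivity) hc.ne', Real.log_div (by positivity) hfg.ne',
      Real.log_mul hf.ne' hg.ne'] at h
    rw [Real.log_div hc.ne' hf.ne', Real.log_div hc.ne' hg.ne', Real.log_div hc.ne' hfg.ne']
    linarith
  have hw_sum : ∑ x ∈ Ω, w (f x, g x) / #{y ∈ Ω | (f y, g y) = (f x, g x)} ≤ #Ω * #Ω := by
    rw [sum_div_card_fiber Ω (fun x => (f x, g x)) w]
    calc ∑ z ∈ Ω.image fun x => (f x, g x), w z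
        ≤ ∑ z ∈ Ω.image f ×ˢ Ω.image g, w z := by
          refine sum_le_sum_of_subset_of_nonneg ?_ fun z _ _ => by positivity
          exact image_subset_iff.2 fun x hx =>
            mem_product.2 ⟨mem_image_of_mem f hx, mem_image_of_mem g hx⟩
      _ = #Ω * #Ω := by
          simp only [hw, sum_product, ← mul_sum, ← sum_mul, sum_card_fiber]
  have hsum := sum_le_sum hlog
  rw [sum_add_distrib, sum_add_distrib, sum_sub_distrib, ← sum_div, sum_const, nsmul_eq_mul,
    mul_one] at hsum
  simp only [unifEntropy, ← add_div]
  refine div_le_div_of_nonneg_right ?_ hc.le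
  linarith [(div_le_iff₀ hc).2 hw_sum]

theorem card_mul_unifEntropy_chain_rule {k : α → γ} {f : α → β} (h : k.FactorsThrough f)
    (Ω : Finset α) :
    #Ω * unifEntropy Ω f = #Ω * unifEntropy Ω k +
      ∑ c ∈ Ω.image k, #{x ∈ Ω | k x = c} * unifEntropy {x ∈ Ω | k x = c} f := by
  have hlog : ∀ x ∈ Ω, Real.log (#Ω / #{y ∈ Ω | f y = f x}) =
      Real.log (#Ω / #{y ∈ Ω | k y = k x}) +
        Real.log (#{y ∈ Ω | k y = k x} / #{y ∈ Ω | f y = f x}) := by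
    intro x hx
    have hc : (#Ω : ℝ) ≠ 0 := by exact_mod_cast (card_pos.2 ⟨x, hx⟩).ne'
    rw [← Real.log_mul (div_ne_zero hc (card_fiber_pos k hx).ne')
      (div_pos (card_fiber_pos k hx) (card_fiber_pos f hx)).ne',
      div_mul_div_cancel₀ (card_fiber_pos k hx).ne']
  rw [card_mul_unifEntropy, card_mul_unifEntropy, sum_congr rfl hlog, sum_add_distrib,
    ← sum_fiberwise_of_maps_to (g := k) (t := Ω.image k) (fun x => mem_image_of_mem k)
      fun x => Real.log (#{y ∈ Ω | k y = k x} / #{y ∈ Ω | f y = f x})]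
  congr 1
  refine sum_congr rfl fun c _ => ?_
  rw [card_mul_unifEntropy]
  refine sum_congr rfl fun x hx => ?_
  obtain rfl := (mem_filter.1 hx).2
  rw [filter_filter, filter_congr fun y _ => (and_iff_right_of_imp fun hy => h hy :
    k y = k x ∧ f y = f x ↔ f y = f x)]

theorem unifEntropy_submodular (Ω : Finset α) {f : α → β} {g : α → γ} {k : α → δ}
    (hf : k.FactorsThrough f) (hg : k.FactorsThrough g) :
    unifEntropy Ω (fun x => (f x, g x)) + unifEntropy Ω k ≤
      unifEntropy Ω f + unifEntropy Ω g := by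
  rcases Ω.eq_empty_or_nonempty with rfl | hΩ
  · simp [unifEntropy]
  have hc : (0 : ℝ) < #Ω := by exact_mod_cast hΩ.card_pos
  have hfiber : ∑ c ∈ Ω.image k,
      (#{x ∈ Ω | k x = c} : ℝ) * unifEntropy {x ∈ Ω | k x = c} (fun x => (f x, g x)) ≤
      ∑ c ∈ Ω.image k, (#{x ∈ Ω | k x = c} : ℝ) *
        (unifEntropy {x ∈ Ω | k x = c} f + unifEntropy {x ∈ Ω | k x = c} g) :=
    sum_le_sum fun c _ =>
      mul_le_mul_of_nonneg_left (unifEntropy_prodMk_le _ f g) (Nat.cast_nonneg _)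
  simp only [mul_add, sum_add_distrib] at hfiber
  have hfg : k.FactorsThrough fun x => (f x, g x) := fun x y h => hf (Prod.ext_iff.1 h).1
  refine le_of_mul_le_mul_left ?_ hc
  linarith [card_mul_unifEntropy_chain_rule hf Ω, card_mul_unifEntropy_chain_rule hg Ω,
    card_mul_unifEntropy_chain_rule hfg Ω]

theorem unifCondEntropy_le_of_factorsThrough (Ω : Finset α) (f : α → β) {k : α → γ} {k' : α → δ}
    (h : k'.FactorsThrough k) : unifCondEntropy Ω f k ≤ unifCondEntropy Ω f k' := by
  have hsub := unifEntropy_submodular Ω (f := fun x => (f x, k' x)) (g := k) (k := k')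
    (fun x y hxy => (Prod.ext_iff.1 hxy).2) h
  have hcongr : unifEntropy Ω (fun x => ((f x, k' x), k x)) =
      unifEntropy Ω fun x => (f x, k x) :=
    unifEntropy_congr fun x _ y _ => by
      simp only [Prod.mk.injEq]
      exact ⟨fun e => ⟨e.1.1, e.2⟩, fun e => ⟨⟨e.1, h e.2⟩, e.2⟩⟩
  simp only [unifCondEntropy]
  linarith

theorem unifCondEntropy_le_unifEntropy (Ω : Finset α) (f : α → β) (k : α → γ) :
    unifCondEntropy Ω f k ≤ unifEntropy Ω f := by
  linarith [unifEntropy_prodMk_le Ω f k, unifCondEntropy.eq_1 Ω f k]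

theorem unifCondEntropy_prodMk_le (Ω : Finset α) (f : α → β) (g : α → γ) (k : α → δ) :
    unifCondEntropy Ω (fun x => (f x, g x)) k ≤ unifCondEntropy Ω f k + unifCondEntropy Ω g k := by
  have hsub := unifEntropy_submodular Ω (f := fun x => (f x, k x)) (g := fun x => (g x, k x))
    (k := k) (fun x y h => (Prod.ext_iff.1 h).2) (fun x y h => (Prod.ext_iff.1 h).2)
  have hcongr : unifEntropy Ω (fun x => ((f x, k x), g x, k x)) =
      unifEntropy Ω fun x => ((f x, g x), k x) :=
    unifEntropy_congr fun x _ y _ => by simp only [Prod.mk.injEq]; tauto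
  simp only [unifCondEntropy]
  linarith

theorem unifCondEntropy_inter_le {X : Type*} [DecidableEq X] (Ω : Finset α) (F : α → Finset X)
    (k : α → γ) (s : Finset X) :
    unifCondEntropy Ω (fun x => F x ∩ s) k ≤
      ∑ i ∈ s, unifCondEntropy Ω (fun x => decide (i ∈ F x)) k := by
  induction s using Finset.induction_on with
  | empty =>
    have hcongr : unifEntropy Ω (fun x => ((∅ : Finset X), k x)) = unifEntropy Ω k :=
      unifEntropy_congr fun x _ y _ => by simp
    simp only [unifCondEntropy, inter_empty, hcongr, sub_self, sum_empty, le_refl]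
  | insert i s hi ih =>
    have hcongr : unifEntropy Ω (fun x => (F x ∩ insert i s, k x)) =
        unifEntropy Ω fun x => ((decide (i ∈ F x), F x ∩ s), k x) :=
      unifEntropy_congr fun x _ y _ => by
        simp only [Prod.mk.injEq, Finset.ext_iff, mem_inter, mem_insert, decide_eq_decide]
        grind
    have hpair := unifCondEntropy_prodMk_le Ω (fun x => decide (i ∈ F x)) (fun x => F x ∩ s) k
    rw [sum_insert hi]
    simp only [unifCondEntropy] at hpair ih ⊢
    linarith

theorem unifEntropy_decide (Ω : Finset α) (P : α → Prop) [DecidablePred P] :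
    unifEntropy Ω (fun x => decide (P x)) = Real.binEntropy (#{x ∈ Ω | P x} / #Ω) := by
  rcases Ω.eq_empty_or_nonempty with rfl | hΩ
  · simp [unifEntropy]
  have hc : (#Ω : ℝ) ≠ 0 := by exact_mod_cast hΩ.card_ne_zero
  have hnot : (#{x ∈ Ω | ¬ P x} : ℝ) = #Ω - #{x ∈ Ω | P x} :=
    eq_sub_of_add_eq' (mod_cast card_filter_add_card_filter_not (s := Ω) P)
  have hlog : ∀ x ∈ Ω, Real.log (#Ω / #{y ∈ Ω | decide (P y) = decide (P x)}) =
      if P x then Real.log (#Ω / #{y ∈ Ω | P y}) else Real.log (#Ω / #{y ∈ Ω | ¬ P y}) := by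
    intro x _
    split_ifs with h <;> simp [h]
  rw [unifEntropy, sum_congr rfl hlog, sum_ite, sum_const, sum_const, nsmul_eq_mul, nsmul_eq_mul,
    hnot, Real.binEntropy, one_sub_div hc, inv_div, inv_div]
  ring

/-- As `a` and `b` are independent, conditioning on `k b` only fixes the second argument of `g`. -/
theorem unifEntropy_product {ι : Type*} {A : Finset α} (hA : A.Nonempty) (B : Finset ι) (k : ι → γ)
    (g : α → γ → δ) :
    unifEntropy (A ×ˢ B) (fun z => (g z.1 (k z.2), k z.2)) =
      unifEntropy B k + (∑ b ∈ B, unifEntropy A (g · (k b))) / #B := by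
  have hcA : (#A : ℝ) ≠ 0 := by exact_mod_cast hA.card_ne_zero
  have hfiber : ∀ a b, {z ∈ A ×ˢ B | (g z.1 (k z.2), k z.2) = (g a (k b), k b)} =
      {a' ∈ A | g a' (k b) = g a (k b)} ×ˢ {b' ∈ B | k b' = k b} := by
    intro a b
    ext ⟨a', b'⟩
    simp only [mem_filter, mem_product, Prod.mk.injEq]
    grind
  have hlog : ∀ b ∈ B, ∀ a ∈ A, Real.log (#(A ×ˢ B) /
      #{z ∈ A ×ˢ B | (g z.1 (k z.2), k z.2) = (g a (k b), k b)}) =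
      Real.log (#A / #{a' ∈ A | g a' (k b) = g a (k b)}) +
        Real.log (#B / #{b' ∈ B | k b' = k b}) := by
    intro b hb a ha
    have hcB : (#B : ℝ) ≠ 0 := by exact_mod_cast (card_pos.2 ⟨b, hb⟩).ne'
    rw [hfiber, card_product, card_product, Nat.cast_mul, Nat.cast_mul, mul_div_mul_comm,
      Real.log_mul (div_ne_zero hcA (card_fiber_pos (g · (k b)) ha).ne')
        (div_ne_zero hcB (card_fiber_pos k hb).ne')]
  have hsum : #(A ×ˢ B) * unifEntropy (A ×ˢ B) (fun z => (g z.1 (k z.2), k z.2)) =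
      #A * (#B * unifEntropy B k + ∑ b ∈ B, unifEntropy A (g · (k b))) := by
    rw [card_mul_unifEntropy, sum_product_right,
      sum_congr rfl fun b hb => sum_congr rfl (hlog b hb)]
    simp only [sum_add_distrib, ← card_mul_unifEntropy, sum_const, nsmul_eq_mul, ← mul_sum]
    ring
  rcases B.eq_empty_or_nonempty with rfl | hB
  · simp [unifEntropy]
  have hcB : (#B : ℝ) ≠ 0 := by exact_mod_cast hB.card_ne_zero
  rw [card_product, Nat.cast_mul, mul_assoc] at hsum
  rw [← mul_right_inj' hcB, mul_left_cancel₀ hcA hsum, mul_add, mul_div_cancel₀ _ hcB]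

theorem unifEntropy_product_snd {ι : Type*} {A : Finset α} (hA : A.Nonempty) (B : Finset ι)
    (k : ι → γ) : unifEntropy (A ×ˢ B) (fun z => k z.2) = unifEntropy B k := by
  have h := unifEntropy_product hA B k fun _ _ => ()
  rw [unifEntropy_congr (g := fun z : α × ι => k z.2) fun _ _ _ _ => by simp] at h
  simpa [unifEntropy_const] using h

theorem unifCondEntropy_product {ι : Type*} {A : Finset α} (hA : A.Nonempty) (B : Finset ι)
    (k : ι → γ) (g : α → γ → δ) :
    unifCondEntropy (A ×ˢ B) (fun z => g z.1 (k z.2)) (fun z => k z.2) =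
      (∑ b ∈ B, unifEntropy A (g · (k b))) / #B := by
  rw [unifCondEntropy, unifEntropy_product hA, unifEntropy_product_snd hA, add_sub_cancel_left]

end Entropy

section Trace

open Finset

variable {X : Type*} [DecidableEq X]

/-- Entropy of the trace on `S` of a uniformly random member of `F`. -/
noncomputable def traceEntropy (F : Finset (Finset X)) (S : Finset X) : ℝ :=
  unifEntropy F (· ∩ S)

/-- Proportion of the members of `F` that contain `i`. -/
noncomputable def density (F : Finset (Finset X)) (i : X) : ℝ :=
  #{T ∈ F | i ∈ T} / #F

theorem density_mem_Icc (F : Finset (Finset X)) (i : X) : density F i ∈ Set.Icc 0 1 :=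
  ⟨by unfold density; positivity,
    div_le_one_of_le₀ (by exact_mod_cast card_filter_le _ _) (by positivity)⟩

theorem card_filter_notMem_div_card {F : Finset (Finset X)} (hF : F.Nonempty) (i : X) :
    (#{T ∈ F | i ∉ T} : ℝ) / #F = 1 - density F i := by
  have hc : (#F : ℝ) ≠ 0 := by exact_mod_cast hF.card_ne_zero
  have hsum : (#{T ∈ F | i ∈ T} + #{T ∈ F | i ∉ T} : ℝ) = #F :=
    mod_cast card_filter_add_card_filter_not (s := F) fun T => i ∈ T
  rw [density, one_sub_div hc, ← hsum, add_sub_cancel_left]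

theorem sum_sum_sdiff [Fintype X] (F : Finset (Finset X)) (Y : Finset X) (b : X → ℝ) :
    ∑ T ∈ F, ∑ i ∈ T \ Y, b i = #F * ∑ i ∈ Yᶜ, density F i * b i := by
  rcases F.eq_empty_or_nonempty with rfl | hF
  · simp
  have hc : (#F : ℝ) ≠ 0 := by exact_mod_cast hF.card_ne_zero
  rw [sum_comm' (t' := Yᶜ) (s' := fun i => {T ∈ F | i ∈ T})
    (by simp only [mem_sdiff, mem_compl, mem_filter]; tauto), mul_sum]
  refine sum_congr rfl fun i _ => ?_
  rw [sum_const, nsmul_eq_mul, ← mul_assoc, density, mul_div_cancel₀ _ hc]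

theorem traceEntropy_empty (F : Finset (Finset X)) : traceEntropy F ∅ = 0 := by
  simp only [traceEntropy, inter_empty, unifEntropy_const]

theorem traceEntropy_univ [Fintype X] (F : Finset (Finset X)) :
    traceEntropy F univ = Real.log #F :=
  unifEntropy_of_injective F fun S T h => by simpa only [inter_univ] using h

theorem traceEntropy_singleton (F : Finset (Finset X)) (i : X) :
    traceEntropy F {i} = Real.binEntropy (density F i) := by
  rw [density, ← unifEntropy_decide F fun T => i ∈ T]
  refine unifEntropy_congr fun S _ T _ => ?_
  simp only [Finset.ext_iff, mem_inter, mem_singleton, decide_eq_decide]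
  grind

theorem traceEntropy_union_add_inter_le (F : Finset (Finset X)) (S T : Finset X) :
    traceEntropy F (S ∪ T) + traceEntropy F (S ∩ T) ≤ traceEntropy F S + traceEntropy F T := by
  have hcongr : unifEntropy F (· ∩ (S ∪ T)) = unifEntropy F fun U => (U ∩ S, U ∩ T) :=
    unifEntropy_congr fun U _ V _ => by
      simp only [Prod.mk.injEq, Finset.ext_iff, mem_inter, mem_union]
      grind
  rw [traceEntropy, hcongr]
  refine unifEntropy_submodular F (fun U V h => ?_) fun U V h => ?_
  · simp only [← inter_assoc, h]
  · simp only [inter_comm S, ← inter_assoc, h]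

theorem unifEntropy_mem_sdiff (A : Finset (Finset X)) {B : Finset (Finset X)} (hB : B.Nonempty)
    (i : X) : unifEntropy (A ×ˢ B) (fun z => decide (i ∈ z.1 \ z.2)) =
      Real.binEntropy (density A i * (1 - density B i)) := by
  have hfilter : {z ∈ A ×ˢ B | i ∈ z.1 \ z.2} = {S ∈ A | i ∈ S} ×ˢ {T ∈ B | i ∉ T} := by
    rw [← filter_product]
    simp only [mem_sdiff]
  rw [unifEntropy_decide, hfilter, card_product, card_product, Nat.cast_mul, Nat.cast_mul,
    mul_div_mul_comm, card_filter_notMem_div_card hB, ← density]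

theorem unifCondEntropy_mem_sdiff {A B : Finset (Finset X)} (hA : A.Nonempty) (hB : B.Nonempty)
    (i : X) :
    unifCondEntropy (A ×ˢ B) (fun z => decide (i ∈ z.1 \ z.2)) (fun z => decide (i ∈ z.2)) =
      (1 - density B i) * Real.binEntropy (density A i) := by
  have hterm : ∀ T ∈ B, unifEntropy A (fun S => decide (i ∈ S) && !decide (i ∈ T)) =
      if i ∉ T then Real.binEntropy (density A i) else 0 := by
    intro T _
    by_cases h : i ∈ T
    · simp [h, unifEntropy_const]
    · simp [h, unifEntropy_decide, density]
  have h := unifCondEntropy_product hA B (fun T => decide (i ∈ T))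
    fun S c => decide (i ∈ S) && !c
  rw [sum_congr rfl hterm, ← sum_filter, sum_const, nsmul_eq_mul, mul_div_right_comm,
    card_filter_notMem_div_card hB] at h
  simpa only [mem_sdiff, Bool.decide_and, decide_not] using h

theorem unifEntropy_sdiff_inter_le [Fintype X] {A B : Finset (Finset X)} (hA : A.Nonempty)
    (hB : B.Nonempty) (Y : Finset X) :
    unifEntropy (A ×ˢ B) (fun z => (z.1 \ z.2, z.2 ∩ Y)) ≤
      traceEntropy B Y + ∑ i, if i ∈ Y then (1 - density B i) * Real.binEntropy (density A i)
        else Real.binEntropy (density A i * (1 - density B i)) := by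
  have hcond : unifCondEntropy (A ×ˢ B) (fun z => z.1 \ z.2) (fun z => z.2 ∩ Y) ≤
      ∑ i, unifCondEntropy (A ×ˢ B) (fun z => decide (i ∈ z.1 \ z.2)) (fun z => z.2 ∩ Y) := by
    simpa only [inter_univ] using
      unifCondEntropy_inter_le (A ×ˢ B) (fun z => z.1 \ z.2) (fun z => z.2 ∩ Y) univ
  have hcoord : ∀ i, unifCondEntropy (A ×ˢ B) (fun z => decide (i ∈ z.1 \ z.2))
      (fun z => z.2 ∩ Y) ≤ if i ∈ Y then (1 - density B i) * Real.binEntropy (density A i)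
        else Real.binEntropy (density A i * (1 - density B i)) := by
    intro i
    split_ifs with hi
    · rw [← unifCondEntropy_mem_sdiff hA hB]
      refine unifCondEntropy_le_of_factorsThrough _ _ fun z w h => ?_
      have hmem := congrArg (i ∈ ·) h
      simpa only [mem_inter, hi, and_true, decide_eq_decide, eq_iff_iff] using hmem
    · rw [← unifEntropy_mem_sdiff A hB]
      exact unifCondEntropy_le_unifEntropy _ _ _
  have htrace : unifEntropy (A ×ˢ B) (fun z => z.2 ∩ Y) = traceEntropy B Y :=
    unifEntropy_product_snd hA B (· ∩ Y)
  have hsum := sum_le_sum fun i (_ : i ∈ univ) => hcoord i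
  rw [unifCondEntropy, htrace] at hcond
  linarith

/-- As `S \ T` determines `S`, the pair `(S \ T, T ∩ Y)` carries as much information as
`(S, T ∩ (S ∪ Y))`. -/
theorem unifEntropy_sdiff_inter_eq {A B : Finset (Finset X)} (hB : B.Nonempty)
    (hAB : ∀ S ∈ A, ∀ S' ∈ A, ∀ T ∈ B, ∀ T' ∈ B, S \ T = S' \ T' → S = S') (Y : Finset X) :
    unifEntropy (A ×ˢ B) (fun z => (z.1 \ z.2, z.2 ∩ Y)) =
      Real.log #A + (∑ S ∈ A, traceEntropy B (S ∪ Y)) / #A := by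
  have hcongr : unifEntropy (A ×ˢ B) (fun z => (z.1 \ z.2, z.2 ∩ Y)) =
      unifEntropy (A ×ˢ B) fun z => (z.2 ∩ (z.1 ∪ Y), z.1) := by
    refine unifEntropy_congr fun z hz w hw => ?_
    rw [mem_product] at hz hw
    simp only [Prod.mk.injEq]
    constructor
    · rintro ⟨hsdiff, hinter⟩
      have hfst := hAB _ hz.1 _ hw.1 _ hz.2 _ hw.2 hsdiff
      refine ⟨?_, hfst⟩
      rw [hfst] at hsdiff ⊢
      simp only [Finset.ext_iff, mem_sdiff, mem_inter, mem_union] at *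
      grind
    · rintro ⟨hinter, hfst⟩
      rw [hfst] at hinter ⊢
      simp only [Finset.ext_iff, mem_sdiff, mem_inter, mem_union] at *
      grind
  have hswap : A ×ˢ B = (B ×ˢ A).map (Equiv.prodComm _ _).toEmbedding :=
    (map_swap_product A B).symm
  rw [hcongr, hswap, unifEntropy_map]
  have h := unifEntropy_product hB A id fun T S => T ∩ (S ∪ Y)
  rwa [unifEntropy_of_injective A Function.injective_id] at h

end Trace

section Coordinates

open Finset MeasureTheory

variable {X : Type*}

/-- The greedy algorithm for polymatroids, adding elements in decreasing order of `l`. -/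
theorem exists_sum_le_of_submodular [DecidableEq X] {E : Finset X → ℝ} (h0 : E ∅ = 0)
    (hE : ∀ S T, E (S ∪ T) + E (S ∩ T) ≤ E S + E T) (l : X → ℝ) (s : Finset X) :
    ∃ b : X → ℝ, (∀ S ⊆ s, ∑ i ∈ S, b i ≤ E S) ∧
      ∀ U ⊆ s, (∀ i ∈ U, ∀ j ∈ s, l i ≤ l j → j ∈ U) → ∑ i ∈ U, b i = E U := by
  induction s using Finset.induction_on_max_value (fun i => -l i) with
  | empty =>
    refine ⟨0, fun S hS => ?_, fun S hS _ => ?_⟩ <;> simp [subset_empty.1 hS, h0]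
  | insert a s ha hmax ih =>
    obtain ⟨b, hle, heq⟩ := ih
    set b' : X → ℝ := Function.update b a (E (insert a s) - E s)
    have hb'_sum : ∀ S, a ∉ S → ∑ i ∈ S, b' i = ∑ i ∈ S, b i :=
      fun S hS => sum_update_of_notMem hS _ _
    have hb'_a : b' a = E (insert a s) - E s := Function.update_self _ _ _
    refine ⟨b', fun S hS => ?_, fun U hU hupper => ?_⟩
    · by_cases haS : a ∈ S
      · have herase : S.erase a ⊆ s := subset_insert_iff.1 hS
        have hunion : S ∪ s = insert a s := by grind
        have hinter : S ∩ s = S.erase a := by grind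
        have hsub := hE S s
        rw [hunion, hinter] at hsub
        rw [← add_sum_erase S b' haS, hb'_sum _ (notMem_erase a S), hb'_a]
        linarith [hle _ herase]
      · rw [hb'_sum S haS]
        exact hle S ((subset_insert_iff_of_notMem haS).1 hS)
    · by_cases haU : a ∈ U
      · have hU_eq : U = insert a s := hU.antisymm fun j hj =>
          hupper a haU j hj <| (mem_insert.1 hj).elim (fun h => h ▸ le_rfl)
            fun h => neg_le_neg_iff.1 (hmax j h)
        have hs := heq s Subset.rfl fun _ _ j hj _ => hj
        rw [hU_eq, sum_insert ha, hb'_sum s ha, hb'_a, hs, sub_add_cancel]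
      · rw [hb'_sum U haU]
        exact heq U ((subset_insert_iff_of_notMem haU).1 hU)
          fun i hi j hj => hupper i hi j (mem_insert_of_mem hj)

theorem integrableOn_ite_lt (l x y : ℝ) :
    IntegrableOn (fun t => if t < l then x else y) (Set.Ico 0 1) :=
  .piecewise (s := Set.Iio l) measurableSet_Iio (integrable_const x).integrableOn
    (integrable_const y).integrableOn

theorem setIntegral_ite_lt {l : ℝ} (hl : l ∈ Set.Icc (0 : ℝ) 1) (x y : ℝ) :
    ∫ t in Set.Ico (0 : ℝ) 1, (if t < l then x else y) = l * x + (1 - l) * y := by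
  have hpiecewise := integral_piecewise (measurableSet_Iio (a := l))
    (integrable_const x).integrableOn
    (integrable_const (μ := volume.restrict (Set.Ico 0 1)) y).integrableOn
  refine hpiecewise.trans ?_
  simp only [setIntegral_const, smul_eq_mul, Set.compl_Iio]
  rw [measureReal_restrict_apply measurableSet_Iio,
    measureReal_restrict_apply measurableSet_Ici, Set.inter_comm, Set.Ico_inter_Iio,
    Set.inter_comm, Set.Ico_inter_Ici, min_eq_right hl.2, max_eq_right hl.1,
    Real.volume_real_Ico_of_le hl.1, Real.volume_real_Ico_of_le hl.2, sub_zero]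

theorem le_sum_of_forall_superlevel [Fintype X] {l x y : X → ℝ} {K : ℝ}
    (hl : ∀ i, l i ∈ Set.Icc (0 : ℝ) 1) (h : ∀ t, K ≤ ∑ i, if t < l i then x i else y i) :
    K ≤ ∑ i, (l i * x i + (1 - l i) * y i) := by
  have hint : ∀ i, IntegrableOn (fun t => if t < l i then x i else y i)
      (Set.Ico 0 1) := fun i => integrableOn_ite_lt _ _ _
  calc K = ∫ _ in Set.Ico (0 : ℝ) 1, K := by simp
    _ ≤ ∫ t in Set.Ico (0 : ℝ) 1, ∑ i, (if t < l i then x i else y i) :=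
        integral_mono (integrable_const K)
          (integrable_finsetSum _ fun i _ => hint i) h
    _ = ∑ i, (l i * x i + (1 - l i) * y i) := by
        rw [integral_finsetSum _ fun i _ => hint i]
        exact sum_congr rfl fun i _ => setIntegral_ite_lt (hl i) _ _

/-- The contribution of a coordinate of densities `p` and `q` in the two families when it lies in
the conditioning set `Y` for a proportion `l` of the superlevel sets `Y`. -/
noncomputable def coordBound (κ l p q : ℝ) : ℝ :=
  (1 - l) * Real.binEntropy (p * (1 - q)) + l * ((1 - q) * Real.binEntropy p) +
    (κ - p * (1 - l)) * Real.binEntropy q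

/-- The weights `l` for which the coefficient of `binEntropy q` in `coordBound κ l p q` is
nonnegative. -/
def admissibleWeights (κ p : ℝ) : Set ℝ :=
  {l | l ∈ Set.Icc 0 1 ∧ p * (1 - l) ≤ κ}

variable [DecidableEq X] [Fintype X] {A B : Finset (Finset X)}

theorem log_card_le_of_sum_le_traceEntropy (hA : A.Nonempty) (hB : B.Nonempty)
    (hAB : ∀ S ∈ A, ∀ S' ∈ A, ∀ T ∈ B, ∀ T' ∈ B, S \ T = S' \ T' → S = S') {b : X → ℝ}
    (hb : ∀ S, ∑ i ∈ S, b i ≤ traceEntropy B S) {Y : Finset X}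
    (hY : ∑ i ∈ Y, b i = traceEntropy B Y) :
    Real.log #A ≤ ∑ i, if i ∈ Y then (1 - density B i) * Real.binEntropy (density A i)
      else Real.binEntropy (density A i * (1 - density B i)) - density A i * b i := by
  have hcA : (0 : ℝ) < #A := by exact_mod_cast hA.card_pos
  have havg : ∑ i ∈ Y, b i + ∑ i ∈ Yᶜ, density A i * b i ≤
      (∑ S ∈ A, traceEntropy B (S ∪ Y)) / #A := by
    rw [le_div_iff₀ hcA]
    calc (∑ i ∈ Y, b i + ∑ i ∈ Yᶜ, density A i * b i) * #A
        = ∑ S ∈ A, ∑ i ∈ S ∪ Y, b i := by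
          have hunion : ∀ S, ∑ i ∈ S ∪ Y, b i = ∑ i ∈ S \ Y, b i + ∑ i ∈ Y, b i := fun S => by
            rw [← sum_union sdiff_disjoint, sdiff_union_self_eq_union]
          simp only [hunion, sum_add_distrib, sum_sum_sdiff, sum_const, nsmul_eq_mul]
          ring
      _ ≤ ∑ S ∈ A, traceEntropy B (S ∪ Y) := sum_le_sum fun S _ => hb _
  have hle := unifEntropy_sdiff_inter_le hA hB Y
  rw [unifEntropy_sdiff_inter_eq hB hAB Y] at hle
  have hsplit : ∑ i, (if i ∈ Y then (1 - density B i) * Real.binEntropy (density A i)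
      else Real.binEntropy (density A i * (1 - density B i)) - density A i * b i) =
      ∑ i, (if i ∈ Y then (1 - density B i) * Real.binEntropy (density A i)
        else Real.binEntropy (density A i * (1 - density B i))) -
        ∑ i ∈ Yᶜ, density A i * b i := by
    have hcompl : ∑ i ∈ Yᶜ, density A i * b i = ∑ i, if i ∈ Yᶜ then density A i * b i else 0 := by
      rw [sum_ite_mem, univ_inter]
    rw [hcompl, ← sum_sub_distrib]
    refine sum_congr rfl fun i _ => ?_
    simp only [mem_compl]
    split_ifs <;> ring
  linarith

theorem log_card_add_mul_log_card_le (hA : A.Nonempty) (hB : B.Nonempty)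
    (hAB : ∀ S ∈ A, ∀ S' ∈ A, ∀ T ∈ B, ∀ T' ∈ B, S \ T = S' \ T' → S = S') {κ : ℝ} {l : X → ℝ}
    (hl : ∀ i, l i ∈ admissibleWeights κ (density A i)) :
    Real.log #A + κ * Real.log #B ≤ ∑ i, coordBound κ (l i) (density A i) (density B i) := by
  obtain ⟨b, hb, hb_upper⟩ := exists_sum_le_of_submodular (traceEntropy_empty B)
    (traceEntropy_union_add_inter_le B) l univ
  have hsum_b : ∑ i, b i = Real.log #B :=
    (hb_upper univ Subset.rfl fun _ _ _ _ _ => mem_univ _).trans (traceEntropy_univ B)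
  have hb_le : ∀ i, b i ≤ Real.binEntropy (density B i) := fun i => by
    simpa only [sum_singleton, traceEntropy_singleton] using hb {i} (subset_univ _)
  have hlevel : ∀ t, Real.log #A ≤ ∑ i, if t < l i then
      (1 - density B i) * Real.binEntropy (density A i)
      else Real.binEntropy (density A i * (1 - density B i)) - density A i * b i := by
    intro t
    have hY := hb_upper {i | t < l i} (subset_univ _) fun i hi j _ hij =>
      mem_filter_univ _ |>.2 <| ((mem_filter_univ _).1 hi).trans_le hij
    simpa only [mem_filter_univ] using
      log_card_le_of_sum_le_traceEntropy hA hB hAB (fun S => hb S (subset_univ _)) hY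
  calc Real.log #A + κ * Real.log #B
      ≤ ∑ i, (l i * ((1 - density B i) * Real.binEntropy (density A i)) + (1 - l i) *
          (Real.binEntropy (density A i * (1 - density B i)) - density A i * b i)) +
          κ * ∑ i, b i := by
        rw [hsum_b]
        gcongr
        exact le_sum_of_forall_superlevel (fun i => (hl i).1) hlevel
    _ ≤ ∑ i, coordBound κ (l i) (density A i) (density B i) := by
        rw [mul_sum, ← sum_add_distrib]
        refine sum_le_sum fun i _ => ?_
        have hcoeff := mul_le_mul_of_nonneg_left (hb_le i) (sub_nonneg.2 (hl i).2)
        unfold coordBound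
        linarith

end Coordinates

section Certificate

theorem binEntropy_le_mul_neg_log {u x : ℝ} (hu : u ∈ Set.Ioo 0 1) (hx : x ∈ Set.Icc 0 1) :
    Real.binEntropy x ≤ x * -Real.log u + (1 - x) * -Real.log (1 - u) := by
  have hterm : ∀ y v : ℝ, 0 ≤ y → 0 < v → y * Real.log y⁻¹ ≤ y * -Real.log v + (v - y) := by
    intro y v hy hv
    rcases hy.eq_or_lt with rfl | hy
    · simpa using hv.le
    · have h := mul_le_mul_of_nonneg_left (Real.log_le_sub_one_of_pos (div_pos hv hy)) hy.le
      rw [Real.log_div hv.ne' hy.ne', mul_sub_one, mul_div_cancel₀ _ hy.ne'] at h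
      rw [Real.log_inv]
      linarith
  have h₁ := hterm x u hx.1 hu.1
  have h₀ := hterm (1 - x) (1 - u) (sub_nonneg.2 hx.2) (sub_pos.2 hu.2)
  rw [Real.binEntropy]
  linarith

/-- A rational upper bound for `-log (k / 12)`, for `1 ≤ k ≤ 11`. -/
def negLogUpper (k : ℕ) : ℚ :=
  ([24850, 17918, 13863, 10987, 8755, 6932, 5390, 4055, 2877, 1824, 871].getD (k - 1) 0 : ℕ) /
    10000

theorem negLogUpper_nonneg (k : ℕ) : 0 ≤ negLogUpper k :=
  div_nonneg (Nat.cast_nonneg _) (by norm_num)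

theorem one_le_mul_taylor_negLogUpper : ∀ k ∈ Finset.Icc (1 : ℕ) 11,
    1 ≤ (k / 12 : ℚ) * ∑ j ∈ Finset.range 16, negLogUpper k ^ j / (j.factorial : ℚ) := by
  decide +kernel

theorem neg_log_le_negLogUpper {k : ℕ} (hk : k ∈ Finset.Icc 1 11) :
    -Real.log (k / 12) ≤ negLogUpper k := by
  have htaylor := (Rat.cast_le (K := ℝ)).2 (one_le_mul_taylor_negLogUpper k hk)
  push_cast at htaylor
  have hpos : (0 : ℝ) < k / 12 := by
    have := (Finset.mem_Icc.1 hk).1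
    positivity
  have hexp : 1 ≤ k / 12 * Real.exp (negLogUpper k) :=
    htaylor.trans <| mul_le_mul_of_nonneg_left
      (Real.sum_le_exp_of_nonneg (mod_cast negLogUpper_nonneg k) 16) hpos.le
  have hlog := Real.log_nonneg hexp
  rw [Real.log_mul hpos.ne' (Real.exp_pos _).ne', Real.log_exp] at hlog
  linarith

/-- The `k` for which `k / 12` is the fraction in `(0, 1)` nearest to `u`. -/
def tangentNode (u : ℚ) : ℕ := max 1 (min 11 ⌊12 * u + 1 / 2⌋₊)

section Tangent

variable {R : Type*} [Field R]

/-- An affine upper bound for the binary entropy, almost tangent to its graph near `u`. -/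
def entropyTangent (u : ℚ) (x : R) : R :=
  x * negLogUpper (tangentNode u) + (1 - x) * negLogUpper (12 - tangentNode u)

/-- The upper bound for `coordBound κ l p q` obtained by replacing each entropy by an affine
function that is sharp near `p = p₀`, `q = q₀`. -/
def coordTangent (κ l : R) (p₀ q₀ : ℚ) (p q : R) : R :=
  (1 - l) * entropyTangent (p₀ * (1 - q₀)) (p * (1 - q)) + l * ((1 - q) * entropyTangent p₀ p) +
    (κ - p * (1 - l)) * entropyTangent q₀ q

/-- An upper bound, affine in `p` and in `q`, for the minimum of
`coordBound κ l p q + coordBound κ l' q p` over all admissible `l` and `l'`, for `(p, q)` in the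
square `[x, x + s] × [y, y + s]`. It uses the same `l` and `l'` on the whole square. -/
def squareBound (κ x y s : ℚ) (p q : R) : R :=
  coordTangent (κ : R) (max 0 (1 - κ / (x + s)) : ℚ) (x + s / 2) (y + s / 2) p q +
    coordTangent (κ : R) (max 0 (1 - κ / (y + s)) : ℚ) (y + s / 2) (x + s / 2) q p

theorem sq_mul_squareBound (κ x y s : ℚ) (x₁ y₁ s₁ p q : R) :
    s₁ ^ 2 * squareBound κ x y s p q =
      (x₁ + s₁ - p) * (y₁ + s₁ - q) * squareBound κ x y s x₁ y₁ +
      (p - x₁) * (y₁ + s₁ - q) * squareBound κ x y s (x₁ + s₁) y₁ +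
      (x₁ + s₁ - p) * (q - y₁) * squareBound κ x y s x₁ (y₁ + s₁) +
      (p - x₁) * (q - y₁) * squareBound κ x y s (x₁ + s₁) (y₁ + s₁) := by
  simp only [squareBound, coordTangent, entropyTangent]
  ring

end Tangent

theorem binEntropy_le_entropyTangent (u : ℚ) {x : ℝ} (hx : x ∈ Set.Icc 0 1) :
    Real.binEntropy x ≤ entropyTangent u x := by
  have hnode : 1 ≤ tangentNode u ∧ tangentNode u ≤ 11 :=
    ⟨le_max_left _ _, max_le (by norm_num) (min_le_left _ _)⟩
  rw [entropyTangent]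
  generalize tangentNode u = k at hnode ⊢
  have hcompl : (1 - k / 12 : ℝ) = (12 - k : ℕ) / 12 := by
    rw [Nat.cast_sub (by lia)]
    push_cast
    ring
  have hk : (k / 12 : ℝ) ∈ Set.Ioo 0 1 := by
    have h₁ : (1 : ℝ) ≤ k := mod_cast hnode.1
    have h₂ : (k : ℝ) ≤ 11 := mod_cast hnode.2
    constructor <;> linarith
  refine (binEntropy_le_mul_neg_log hk hx).trans (add_le_add ?_ ?_)
  · exact mul_le_mul_of_nonneg_left (neg_log_le_negLogUpper (Finset.mem_Icc.2 hnode)) hx.1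
  · rw [hcompl]
    exact mul_le_mul_of_nonneg_left (neg_log_le_negLogUpper (Finset.mem_Icc.2 (by lia)))
      (sub_nonneg.2 hx.2)

theorem coordBound_le_coordTangent {κ l p q : ℝ} (hl : l ∈ admissibleWeights κ p)
    (hp : p ∈ Set.Icc 0 1) (hq : q ∈ Set.Icc 0 1) (p₀ q₀ : ℚ) :
    coordBound κ l p q ≤ coordTangent κ l p₀ q₀ p q := by
  have hq' : 0 ≤ 1 - q := sub_nonneg.2 hq.2
  have hprod : p * (1 - q) ∈ Set.Icc 0 1 :=
    ⟨mul_nonneg hp.1 hq', mul_le_one₀ hp.2 hq' (sub_le_self 1 hq.1)⟩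
  refine add_le_add (add_le_add ?_ ?_) ?_
  · exact mul_le_mul_of_nonneg_left (binEntropy_le_entropyTangent _ hprod) (sub_nonneg.2 hl.1.2)
  · exact mul_le_mul_of_nonneg_left
      (mul_le_mul_of_nonneg_left (binEntropy_le_entropyTangent _ hp) hq') hl.1.1
  · exact mul_le_mul_of_nonneg_left (binEntropy_le_entropyTangent _ hq) (sub_nonneg.2 hl.2)

theorem max_zero_one_sub_div_mem_admissibleWeights {κ p u : ℝ} (hκ : 0 ≤ κ) (hp : 0 ≤ p)
    (hpu : p ≤ u) : max 0 (1 - κ / u) ∈ admissibleWeights κ p := by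
  have hu := hp.trans hpu
  refine ⟨⟨le_max_left _ _, max_le zero_le_one (sub_le_self 1 (div_nonneg hκ hu))⟩, ?_⟩
  calc p * (1 - max 0 (1 - κ / u)) ≤ p * (κ / u) :=
        mul_le_mul_of_nonneg_left (sub_le_comm.1 (le_max_right _ _)) hp
    _ = p / u * κ := by ring
    _ ≤ κ := mul_le_of_le_one_left hκ (div_le_one_of_le₀ hpu hu)

/-- The coordinate inequality: with the best admissible weights, a coordinate of densities `p` and
`q` contributes at most `M` to the sum of the two bounds of `log_card_add_mul_log_card_le`. -/
def HasCoordBound (κ M p q : ℝ) : Prop :=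
  ∃ l ∈ admissibleWeights κ p, ∃ l' ∈ admissibleWeights κ q,
    coordBound κ l p q + coordBound κ l' q p ≤ M

/-- `squareBound` is at most `M` at the corners of the square `[x, x + s] × [y, y + s]`. -/
abbrev SquareCertified (κ M x y s : ℚ) : Prop :=
  ∀ p ∈ [x, x + s], ∀ q ∈ [y, y + s], squareBound κ x y s p q ≤ M

theorem SquareCertified.squareBound_le {κ M x y s : ℚ} (h : SquareCertified κ M x y s)
    (hs : 0 < s) {p q : ℝ} (hp : p ∈ Set.Icc (x : ℝ) (x + s)) (hq : q ∈ Set.Icc (y : ℝ) (y + s)) :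
    squareBound κ x y s p q ≤ (M : ℝ) := by
  have hcast : ∀ p q : ℚ, ((squareBound κ x y s p q : ℚ) : ℝ) = squareBound κ x y s (p : ℝ) q := by
    intro p q
    simp only [squareBound, coordTangent, entropyTangent]
    push_cast
    rfl
  have hcorner : ∀ p ∈ [x, x + s], ∀ q ∈ [y, y + s], squareBound κ x y s (p : ℝ) q ≤ M :=
    fun p hp q hq => (hcast p q).symm.trans_le (Rat.cast_le.2 (h p hp q hq))
  simp only [List.mem_cons, List.not_mem_nil, or_false, forall_eq_or_imp, forall_eq] at hcorner
  push_cast at hcorner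
  obtain ⟨⟨h₀₀, h₀₁⟩, h₁₀, h₁₁⟩ := hcorner
  have hs' : (0 : ℝ) < (s : ℝ) ^ 2 := by positivity
  have hp₀ := sub_nonneg.2 hp.1
  have hp₁ := sub_nonneg.2 hp.2
  have hq₀ := sub_nonneg.2 hq.1
  have hq₁ := sub_nonneg.2 hq.2
  refine le_of_mul_le_mul_left ?_ hs'
  rw [sq_mul_squareBound κ x y s (x : ℝ) y s]
  calc _ ≤ (x + s - p) * (y + s - q) * (M : ℝ) + (p - x) * (y + s - q) * M +
        (x + s - p) * (q - y) * M + (p - x) * (q - y) * M := by gcongr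
    _ = (s : ℝ) ^ 2 * M := by ring

theorem SquareCertified.hasCoordBound {κ M x y s : ℚ} (h : SquareCertified κ M x y s) (hκ : 0 ≤ κ)
    (hs : 0 < s) {p q : ℝ} (hp : p ∈ Set.Icc 0 1) (hq : q ∈ Set.Icc 0 1)
    (hpx : p ∈ Set.Icc (x : ℝ) (x + s)) (hqy : q ∈ Set.Icc (y : ℝ) (y + s)) :
    HasCoordBound κ M p q := by
  have hκ' : (0 : ℝ) ≤ κ := mod_cast hκ
  have hl : ((max 0 (1 - κ / (x + s)) : ℚ) : ℝ) ∈ admissibleWeights κ p := by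
    push_cast
    exact max_zero_one_sub_div_mem_admissibleWeights hκ' hp.1 hpx.2
  have hl' : ((max 0 (1 - κ / (y + s)) : ℚ) : ℝ) ∈ admissibleWeights κ q := by
    push_cast
    exact max_zero_one_sub_div_mem_admissibleWeights hκ' hq.1 hqy.2
  exact ⟨_, hl, _, hl', (add_le_add (coordBound_le_coordTangent hl hp hq _ _)
    (coordBound_le_coordTangent hl' hq hp _ _)).trans (h.squareBound_le hs hpx hqy)⟩

/-- Checks that `[x, x + s] × [y, y + s]` is covered by certified squares, by quartering it at most
`n` times. -/
def certify (κ M : ℚ) : ℕ → ℚ → ℚ → ℚ → Bool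
  | 0, x, y, s => decide (SquareCertified κ M x y s)
  | n + 1, x, y, s => decide (SquareCertified κ M x y s) ||
      (certify κ M n x y (s / 2) && certify κ M n (x + s / 2) y (s / 2) &&
        certify κ M n x (y + s / 2) (s / 2) && certify κ M n (x + s / 2) (y + s / 2) (s / 2))

theorem hasCoordBound_of_certify {κ M : ℚ} (hκ : 0 ≤ κ) {n : ℕ} {x y s : ℚ}
    (h : certify κ M n x y s = true) (hs : 0 < s) {p q : ℝ} (hp : p ∈ Set.Icc 0 1)
    (hq : q ∈ Set.Icc 0 1) (hpx : p ∈ Set.Icc (x : ℝ) (x + s))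
    (hqy : q ∈ Set.Icc (y : ℝ) (y + s)) : HasCoordBound κ M p q := by
  induction n generalizing x y s with
  | zero => exact (of_decide_eq_true h).hasCoordBound hκ hs hp hq hpx hqy
  | succ n ih =>
    simp only [certify, Bool.or_eq_true, Bool.and_eq_true, decide_eq_true_eq] at h
    rcases h with hsquare | ⟨⟨⟨h₀₀, h₁₀⟩, h₀₁⟩, h₁₁⟩
    · exact hsquare.hasCoordBound hκ hs hp hq hpx hqy
    have hhalf : ∀ {x : ℚ} {p : ℝ}, p ∈ Set.Icc (x : ℝ) (x + s) →
        p ∈ Set.Icc (x : ℝ) (x + (s / 2 : ℚ)) ∨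
          p ∈ Set.Icc ((x + s / 2 : ℚ) : ℝ) ((x + s / 2 : ℚ) + (s / 2 : ℚ)) := by
      intro x p hp
      push_cast
      rw [add_assoc, add_halves]
      exact (le_total p (x + s / 2)).imp (fun h => ⟨hp.1, h⟩) fun h => ⟨h, hp.2⟩
    have hs' := half_pos hs
    rcases hhalf hpx with hpx | hpx <;> rcases hhalf hqy with hqy | hqy
    exacts [ih h₀₀ hs' hpx hqy, ih h₀₁ hs' hpx hqy, ih h₁₀ hs' hpx hqy, ih h₁₁ hs' hpx hqy]

theorem hasCoordBound_three_tenths {p q : ℝ} (hp : p ∈ Set.Icc 0 1) (hq : q ∈ Set.Icc 0 1) :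
    HasCoordBound (3 / 10 : ℚ) (13 / 10 * (8108 / 10000) : ℚ) p q := by
  have hcertify : certify (3 / 10) (13 / 10 * (8108 / 10000)) 7 0 0 1 = true := by decide +kernel
  exact hasCoordBound_of_certify (by norm_num) hcertify one_pos hp hq
    (by simpa using hp) (by simpa using hq)

theorem IsRecoveringPair.log_card_add_log_card_le {X : Type*} [Fintype X] [DecidableEq X]
    {A B : Finset (Finset X)} (h : IsRecoveringPair A B) (hA : A.Nonempty) (hB : B.Nonempty)
    {κ M : ℝ} (hcoord : ∀ i, HasCoordBound κ M (density A i) (density B i)) :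
    (1 + κ) * (Real.log A.card + Real.log B.card) ≤ Fintype.card X * M := by
  choose l hl l' hl' hM using hcoord
  have hAB := log_card_add_mul_log_card_le hA hB
    (fun S hS S' hS' T hT T' hT' => (h S hS S' hS' T hT T' hT').1) hl
  have hBA := log_card_add_mul_log_card_le hB hA
    (fun T hT T' hT' S hS S' hS' => (h S hS S' hS' T hT T' hT').2) hl'
  have hsum := Finset.sum_le_card_nsmul Finset.univ _ _ fun i _ => hM i
  rw [Finset.sum_add_distrib, Finset.card_univ, nsmul_eq_mul] at hsum
  linarith

theorem IsRecoveringPair.card_mul_card_le {X : Type*} [Fintype X] [DecidableEq X]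
    {A B : Finset (Finset X)} (h : IsRecoveringPair A B) :
    (A.card : ℝ) * B.card ≤ 2.2499 ^ Fintype.card X := by
  rcases A.eq_empty_or_nonempty with rfl | hA
  · simp only [Finset.card_empty, Nat.cast_zero, zero_mul]
    positivity
  rcases B.eq_empty_or_nonempty with rfl | hB
  · simp only [Finset.card_empty, Nat.cast_zero, mul_zero]
    positivity
  have hbase : (8108 / 10000 : ℝ) ≤ Real.log 2.2499 := by
    rw [Real.le_log_iff_exp_le (by norm_num)]
    refine (Real.exp_bound' (by norm_num) (by norm_num) (n := 8) (by norm_num)).trans ?_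
    norm_num [Finset.sum_range_succ, Nat.factorial]
  have hbase_mul := mul_le_mul_of_nonneg_left hbase (Nat.cast_nonneg (Fintype.card X))
  have hlog := h.log_card_add_log_card_le hA hB fun i =>
    hasCoordBound_three_tenths (density_mem_Icc A i) (density_mem_Icc B i)
  push_cast at hlog
  have hcA : (0 : ℝ) < A.card := by exact_mod_cast hA.card_pos
  have hcB : (0 : ℝ) < B.card := by exact_mod_cast hB.card_pos
  rw [← Real.log_le_log_iff (mul_pos hcA hcB) (by positivity), Real.log_mul hcA.ne' hcB.ne',
    Real.log_pow]
  linarith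

end Certificate

section Limits

/-- The union of two sets placed on consecutive blocks of the ground set. -/
def blockUnion {m n : ℕ} (z : Finset (Fin m) × Finset (Fin n)) : Finset (Fin (m + n)) :=
  (z.1.disjSum z.2).map finSumFinEquiv.toEmbedding

theorem blockUnion_injective {m n : ℕ} : Function.Injective (blockUnion (m := m) (n := n)) := by
  rintro ⟨S, T⟩ ⟨S', T'⟩ h
  simpa only [Finset.disjSum_inj, Prod.mk.injEq] using Finset.map_injective _ h

theorem blockUnion_sdiff {m n : ℕ} (z w : Finset (Fin m) × Finset (Fin n)) :
    blockUnion z \ blockUnion w = blockUnion (z.1 \ w.1, z.2 \ w.2) := by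
  unfold blockUnion
  rw [← Finset.map_sdiff]
  congr 1
  ext (i | i) <;> simp

/-- The family of all block unions of members of two families: the product construction behind
supermultiplicativity of the maximal rates. -/
def blockProd {m n : ℕ} (A : Finset (Finset (Fin m))) (A' : Finset (Finset (Fin n))) :
    Finset (Finset (Fin (m + n))) :=
  (A ×ˢ A').map ⟨blockUnion, blockUnion_injective⟩

theorem card_blockProd {m n : ℕ} (A : Finset (Finset (Fin m))) (A' : Finset (Finset (Fin n))) :
    (blockProd A A').card = A.card * A'.card := by
  rw [blockProd, Finset.card_map, Finset.card_product]

theorem mem_blockProd {m n : ℕ} {A : Finset (Finset (Fin m))} {A' : Finset (Finset (Fin n))}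
    {S : Finset (Fin (m + n))} :
    S ∈ blockProd A A' ↔ ∃ z : Finset (Fin m) × Finset (Fin n),
      (z.1 ∈ A ∧ z.2 ∈ A') ∧ blockUnion z = S := by
  simp only [blockProd, Finset.mem_map, Finset.mem_product, Function.Embedding.coeFn_mk]

theorem IsRecoveringPair.blockProd {m n : ℕ} {A B : Finset (Finset (Fin m))}
    {A' B' : Finset (Finset (Fin n))} (h : IsRecoveringPair A B) (h' : IsRecoveringPair A' B') :
    IsRecoveringPair (blockProd A A') (blockProd B B') := by
  intro S hS S' hS' T hT T' hT'
  obtain ⟨s, hs, rfl⟩ := mem_blockProd.1 hS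
  obtain ⟨s', hs', rfl⟩ := mem_blockProd.1 hS'
  obtain ⟨t, ht, rfl⟩ := mem_blockProd.1 hT
  obtain ⟨t', ht', rfl⟩ := mem_blockProd.1 hT'
  have hfst := h _ hs.1 _ hs'.1 _ ht.1 _ ht'.1
  have hsnd := h' _ hs.2 _ hs'.2 _ ht.2 _ ht'.2
  simp only [blockUnion_sdiff, blockUnion_injective.eq_iff, Prod.mk.injEq]
  exact ⟨fun e => Prod.ext (hfst.1 e.1) (hsnd.1 e.2), fun e => Prod.ext (hfst.2 e.1) (hsnd.2 e.2)⟩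

theorem IsCancellativePair.blockProd {m n : ℕ} {A B : Finset (Finset (Fin m))}
    {A' B' : Finset (Finset (Fin n))} (h : IsCancellativePair A B)
    (h' : IsCancellativePair A' B') :
    IsCancellativePair (blockProd A A') (blockProd B B') := by
  intro S hS S' hS' T hT T' hT'
  obtain ⟨s, hs, rfl⟩ := mem_blockProd.1 hS
  obtain ⟨s', hs', rfl⟩ := mem_blockProd.1 hS'
  obtain ⟨t, ht, rfl⟩ := mem_blockProd.1 hT
  obtain ⟨t', ht', rfl⟩ := mem_blockProd.1 hT'
  have hfst := h _ hs.1 _ hs'.1 _ ht.1 _ ht'.1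
  have hsnd := h' _ hs.2 _ hs'.2 _ ht.2 _ ht'.2
  simp only [blockUnion_sdiff, blockUnion_injective.eq_iff, Prod.mk.injEq]
  exact ⟨fun e => Prod.ext (hfst.1 e.1) (hsnd.1 e.2), fun e => Prod.ext (hfst.2 e.1) (hsnd.2 e.2)⟩

theorem exists_tendsto_of_pow_mul_pow_le {g : ℕ → ℝ} {C : ℝ} (hone : ∀ n, 1 ≤ g n)
    (hC : ∀ n ≠ 0, g n ≤ C) (hmul : ∀ m n, g m ^ m * g n ^ n ≤ g (m + n) ^ (m + n)) :
    ∃ L, Filter.Tendsto g Filter.atTop (nhds L) ∧ ∀ n ≠ 0, g n ≤ L := by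
  have hpos : ∀ n, 0 < g n := fun n => one_pos.trans_le (hone n)
  have hsub : Subadditive fun n => -(n * Real.log (g n)) := by
    intro m n
    have hlog := Real.log_le_log (mul_pos (pow_pos (hpos m) m) (pow_pos (hpos n) n)) (hmul m n)
    rw [Real.log_mul (pow_pos (hpos m) m).ne' (pow_pos (hpos n) n).ne', Real.log_pow,
      Real.log_pow, Real.log_pow] at hlog
    linarith
  have hdiv : ∀ n : ℕ, n ≠ 0 → -(n * Real.log (g n)) / n = -Real.log (g n) := by
    intro n hn
    rw [neg_div, mul_div_cancel_left₀ _ (Nat.cast_ne_zero.2 hn)]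
  have hbdd : BddBelow (Set.range fun n : ℕ => -(n * Real.log (g n)) / n) := by
    refine ⟨-Real.log C, ?_⟩
    rintro _ ⟨n, rfl⟩
    rcases eq_or_ne n 0 with rfl | hn
    · simpa using Real.log_nonneg ((hone 1).trans (hC 1 one_ne_zero))
    · exact (neg_le_neg (Real.log_le_log (hpos n) (hC n hn))).trans_eq (hdiv n hn).symm
  refine ⟨Real.exp (-hsub.lim), ?_, fun n hn => ?_⟩
  · refine ((Real.continuous_exp.tendsto _).comp (hsub.tendsto_lim hbdd).neg).congr' ?_
    filter_upwards [Filter.eventually_ne_atTop 0] with n hn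
    rw [Function.comp_apply, hdiv n hn, neg_neg, Real.exp_log (hpos n)]
  · have hlim := hsub.lim_le_div hbdd hn
    rw [hdiv n hn] at hlim
    rw [← Real.log_le_iff_le_exp (hpos n)]
    linarith

/-- The values `(|A||B|)^(1/n)` over all pairs over an `n`-element set satisfying `Q`; the common
form of `recValues` and `canValues`. -/
def rateValues (Q : ∀ n, Finset (Finset (Fin n)) → Finset (Finset (Fin n)) → Prop) (n : ℕ) :
    Set ℝ :=
  {r | ∃ A B : Finset (Finset (Fin n)), Q n A B ∧
    r = ((A.card : ℝ) * (B.card : ℝ)) ^ (1 / (n : ℝ))}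

variable {Q : ∀ n, Finset (Finset (Fin n)) → Finset (Finset (Fin n)) → Prop}

theorem rateValues_le_four {n : ℕ} (hn : n ≠ 0) {r : ℝ} (hr : r ∈ rateValues Q n) : r ≤ 4 := by
  obtain ⟨A, B, -, rfl⟩ := hr
  have hcard : ∀ A : Finset (Finset (Fin n)), (A.card : ℝ) ≤ 2 ^ n := by
    intro A
    have hA := A.card_le_univ
    rw [Fintype.card_finset, Fintype.card_fin] at hA
    exact_mod_cast hA
  refine le_of_pow_le_pow_left₀ hn (by norm_num) ?_
  rw [one_div, Real.rpow_inv_natCast_pow (by positivity) hn]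
  calc (A.card : ℝ) * B.card ≤ 2 ^ n * 2 ^ n := by gcongr <;> exact hcard _
    _ = 4 ^ n := by rw [← mul_pow]; norm_num

theorem pow_mul_pow_le_of_isGreatest_rateValues {g : ℕ → ℝ}
    (hQ : ∀ {m n : ℕ} {A B : Finset (Finset (Fin m))} {A' B' : Finset (Finset (Fin n))},
      Q m A B → Q n A' B' → Q (m + n) (blockProd A A') (blockProd B B'))
    (hg : ∀ n, IsGreatest (rateValues Q n) (g n)) (m n : ℕ) :
    g m ^ m * g n ^ n ≤ g (m + n) ^ (m + n) := by
  rcases eq_or_ne m 0 with rfl | hm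
  · simp
  rcases eq_or_ne n 0 with rfl | hn
  · simp
  obtain ⟨A, B, hAB, hgm⟩ := (hg m).1
  obtain ⟨A', B', hAB', hgn⟩ := (hg n).1
  have hle := (hg (m + n)).2 ⟨_, _, hQ hAB hAB', rfl⟩
  calc g m ^ m * g n ^ n
      = ((blockProd A A').card : ℝ) * (blockProd B B').card := by
        rw [hgm, hgn, one_div, one_div, Real.rpow_inv_natCast_pow (by positivity) hm,
          Real.rpow_inv_natCast_pow (by positivity) hn, card_blockProd, card_blockProd]
        push_cast
        ring
    _ = ((((blockProd A A').card : ℝ) * (blockProd B B').card) ^ (1 / ((m + n : ℕ) : ℝ))) ^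
          (m + n) := by
        rw [one_div, Real.rpow_inv_natCast_pow (by positivity) (by lia)]
    _ ≤ g (m + n) ^ (m + n) := pow_le_pow_left₀ (by positivity) hle _

theorem exists_tendsto_of_isGreatest_rateValues {g : ℕ → ℝ}
    (hempty : ∀ n, Q n {∅} {∅})
    (hQ : ∀ {m n : ℕ} {A B : Finset (Finset (Fin m))} {A' B' : Finset (Finset (Fin n))},
      Q m A B → Q n A' B' → Q (m + n) (blockProd A A') (blockProd B B'))
    (hg : ∀ n, IsGreatest (rateValues Q n) (g n)) :
    ∃ L, Filter.Tendsto g Filter.atTop (nhds L) ∧ ∀ n ≠ 0, g n ≤ L :=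
  exists_tendsto_of_pow_mul_pow_le (fun n => (hg n).2 ⟨{∅}, {∅}, hempty n, by simp⟩)
    (fun n hn => rateValues_le_four hn (hg n).1)
    (pow_mul_pow_le_of_isGreatest_rateValues hQ hg)

theorem tendsto_maxRec : Filter.Tendsto maxRec Filter.atTop (nhds muRec) := by
  obtain ⟨L, hL, -⟩ := exists_tendsto_of_isGreatest_rateValues (Q := fun _ => IsRecoveringPair)
    (fun n => by simp [IsRecoveringPair]) IsRecoveringPair.blockProd isGreatest_maxRec
  rwa [muRec, hL.limUnder_eq]

theorem tendsto_maxCan_and_maxCan_le_muCan :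
    Filter.Tendsto maxCan Filter.atTop (nhds muCan) ∧ ∀ n ≠ 0, maxCan n ≤ muCan := by
  obtain ⟨L, hL, hle⟩ := exists_tendsto_of_isGreatest_rateValues
    (Q := fun _ => IsCancellativePair) (fun n => by simp [IsCancellativePair])
    IsCancellativePair.blockProd isGreatest_maxCan
  rw [muCan, hL.limUnder_eq]
  exact ⟨hL, hle⟩

theorem IsCancellativePair.card_mul_card_le {n : ℕ} (hn : n ≠ 0) {A B : Finset (Finset (Fin n))}
    (h : IsCancellativePair A B) : (A.card : ℝ) * B.card ≤ muCan ^ n := by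
  have hle := ((isGreatest_maxCan n).2 ⟨A, B, h, rfl⟩).trans
    (tendsto_maxCan_and_maxCan_le_muCan.2 n hn)
  calc (A.card : ℝ) * B.card = (((A.card : ℝ) * B.card) ^ (1 / (n : ℝ))) ^ n := by
        rw [one_div, Real.rpow_inv_natCast_pow (by positivity) hn]
    _ ≤ muCan ^ n := pow_le_pow_left₀ (by positivity) hle n

end Limits

section RandomLinear

variable {ι V : Type*} [AddCommGroup V]

/-- No nonempty subset of `S` has `H`-sum zero. When `V` is an `𝔽₂`-vector space, this says that
the columns `H i`, `i ∈ S`, of the matrix `H` are linearly independent. -/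
def ZeroSumFree (H : ι → V) (S : Finset ι) : Prop :=
  ∀ U ⊆ S, ∑ i ∈ U, H i = 0 → U = ∅

theorem isCancellativePair_of_zeroSumFree [DecidableEq ι] (hV : ∀ v : V, v + v = 0) {H : ι → V}
    {s : V} {F : Finset (Finset ι)} (hfree : ∀ S ∈ F, ZeroSumFree H S)
    (hsum : ∀ S ∈ F, ∑ i ∈ S, H i = s) : IsCancellativePair F F := by
  suffices hkey : ∀ S ∈ F, ∀ S' ∈ F, ∀ T ∈ F, S \ T = S' \ T → S = S' from
    fun S hS S' hS' T hT T' hT' => ⟨hkey S hS S' hS' T hT, hkey T hT T' hT' S hS⟩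
  intro S hS S' hS' T hT hdiff
  have hsymmDiff_subset : symmDiff S S' ⊆ T := by
    intro i hi
    by_contra hiT
    have hmem := Finset.ext_iff.1 hdiff i
    simp only [Finset.mem_sdiff, Finset.mem_symmDiff] at hmem hi
    tauto
  have hsymmDiff_sum : ∑ i ∈ symmDiff S S', H i = 0 := by
    have hS_sum := Finset.sum_inter_add_sum_sdiff S S' H
    have hS'_sum := Finset.sum_inter_add_sum_sdiff S' S H
    rw [hsum S hS] at hS_sum
    rw [hsum S' hS', Finset.inter_comm] at hS'_sum
    rw [symmDiff, Finset.sup_eq_union, Finset.sum_union disjoint_sdiff_sdiff,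
      add_left_cancel (hS_sum.trans hS'_sum.symm), hV]
  exact symmDiff_eq_bot.1 (hfree T hT _ hsymmDiff_subset hsymmDiff_sum)

variable [Fintype V]

theorem exists_card_le_card_filter_eq_mul_card [DecidableEq V] {α : Type*} (F : Finset α)
    (f : α → V) :
    ∃ v, F.card ≤ (F.filter fun x => f x = v).card * Fintype.card V := by
  obtain ⟨v, -, hv⟩ : ∃ v ∈ Finset.univ, F.card ≤
      (F.filter fun x => f x = v).card * Fintype.card V := by
    refine Finset.exists_le_of_sum_le Finset.univ_nonempty ?_
    rw [Finset.sum_const, smul_eq_mul, Finset.card_univ, ← Finset.sum_mul,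
      ← Finset.card_eq_sum_card_fiberwise (by simp), mul_comm]
  exact ⟨v, hv⟩

theorem card_filter_sum_eq_zero_mul_card [Fintype ι] [DecidableEq ι] [DecidableEq V]
    {U : Finset ι} (hU : U.Nonempty) :
    (Finset.univ.filter fun H : ι → V => ∑ i ∈ U, H i = 0).card * Fintype.card V =
      Fintype.card (ι → V) := by
  obtain ⟨j, hj⟩ := hU
  let sumOn : (ι → V) →+ V := ∑ i ∈ U, Pi.evalAddMonoidHom (fun _ => V) i
  have hsumOn : ∀ H : ι → V, sumOn H = ∑ i ∈ U, H i := fun H => by simp [sumOn]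
  have hsurj : Function.Surjective sumOn := fun v =>
    ⟨Pi.single j v, by simp [hsumOn, Pi.single_apply, hj]⟩
  simp_rw [← hsumOn]
  have hfiber := Finset.card_eq_sum_card_fiberwise (s := (Finset.univ : Finset (ι → V)))
    (t := (Finset.univ : Finset V)) (f := sumOn) (by simp)
  rw [Finset.sum_congr rfl fun v _ => AddMonoidHom.card_fiber_eq_of_mem_range sumOn
    (hsurj v) (hsurj 0), Finset.sum_const, smul_eq_mul, Finset.card_univ, Finset.card_univ]
    at hfiber
  rw [hfiber, mul_comm]

open scoped Classical in
theorem card_le_two_mul_card_filter_zeroSumFree [Fintype ι] [DecidableEq ι] {S : Finset ι}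
    (hS : 2 ^ (S.card + 1) ≤ Fintype.card V) :
    Fintype.card (ι → V) ≤ 2 * (Finset.univ.filter fun H : ι → V => ZeroSumFree H S).card := by
  have := Classical.decEq V
  set bad := Finset.univ.filter fun H : ι → V => ¬ ZeroSumFree H S with hbad_def
  have hbad_subset : bad ⊆ (S.powerset.erase ∅).biUnion fun U =>
      Finset.univ.filter fun H : ι → V => ∑ i ∈ U, H i = 0 := by
    intro H hH
    simp only [hbad_def, ZeroSumFree, Finset.mem_filter_univ, not_forall] at hH
    obtain ⟨U, hUS, hsum, hU⟩ := hH
    simp only [Finset.mem_biUnion, Finset.mem_erase, Finset.mem_powerset, Finset.mem_filter_univ]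
    exact ⟨U, ⟨hU, hUS⟩, hsum⟩
  have hbad_card : bad.card * Fintype.card V ≤ 2 ^ S.card * Fintype.card (ι → V) := by
    calc bad.card * Fintype.card V
        ≤ (∑ U ∈ S.powerset.erase ∅,
            (Finset.univ.filter fun H : ι → V => ∑ i ∈ U, H i = 0).card) * Fintype.card V :=
          Nat.mul_le_mul_right _ ((Finset.card_le_card hbad_subset).trans Finset.card_biUnion_le)
      _ = (S.powerset.erase ∅).card * Fintype.card (ι → V) := by
          rw [Finset.sum_mul, ← smul_eq_mul, ← Finset.sum_const]
          refine Finset.sum_congr rfl fun U hU => ?_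
          exact card_filter_sum_eq_zero_mul_card
            (Finset.nonempty_iff_ne_empty.2 (Finset.mem_erase.1 hU).1)
      _ ≤ 2 ^ S.card * Fintype.card (ι → V) := by
          rw [← Finset.card_powerset]
          exact Nat.mul_le_mul_right _ Finset.card_erase_le
  have hbad_half : 2 * bad.card ≤ Fintype.card (ι → V) := by
    refine Nat.le_of_mul_le_mul_left ?_ (Nat.two_pow_pos S.card)
    calc 2 ^ S.card * (2 * bad.card) = bad.card * 2 ^ (S.card + 1) := by ring
      _ ≤ bad.card * Fintype.card V := Nat.mul_le_mul_left _ hS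
      _ ≤ 2 ^ S.card * Fintype.card (ι → V) := hbad_card
  have hsplit := Finset.card_filter_add_card_filter_not (s := (Finset.univ : Finset (ι → V)))
    (fun H => ZeroSumFree H S)
  rw [Finset.card_univ] at hsplit
  lia

open scoped Classical in
theorem exists_card_le_two_mul_card_filter_zeroSumFree [Finite ι] {F : Finset (Finset ι)}
    (hF : ∀ S ∈ F, 2 ^ (S.card + 1) ≤ Fintype.card V) :
    ∃ H : ι → V, F.card ≤ 2 * (F.filter (ZeroSumFree H)).card := by
  have := Fintype.ofFinite ι
  obtain ⟨H, -, hH⟩ : ∃ H ∈ (Finset.univ : Finset (ι → V)),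
      F.card ≤ 2 * (F.filter (ZeroSumFree H)).card := by
    refine Finset.exists_le_of_sum_le Finset.univ_nonempty ?_
    calc ∑ _H : ι → V, F.card = ∑ _S ∈ F, Fintype.card (ι → V) := by
          rw [Finset.sum_const, Finset.sum_const, smul_eq_mul, smul_eq_mul, Finset.card_univ,
            mul_comm]
      _ ≤ ∑ S ∈ F, 2 * (Finset.univ.filter fun H : ι → V => ZeroSumFree H S).card :=
          Finset.sum_le_sum fun S hS => card_le_two_mul_card_filter_zeroSumFree (hF S hS)
      _ = ∑ H : ι → V, 2 * (F.filter (ZeroSumFree H)).card := by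
          simp only [← Finset.mul_sum, Finset.card_filter]
          rw [Finset.sum_comm]
  exact ⟨H, hH⟩

theorem exists_isCancellativePair_subset [Finite ι] [DecidableEq ι] {F : Finset (Finset ι)} {k : ℕ}
    (hF : ∀ S ∈ F, S.card ≤ k) :
    ∃ G ⊆ F, IsCancellativePair G G ∧ F.card ≤ G.card * 2 ^ (k + 2) := by
  classical
  have hcard : Fintype.card (Fin (k + 1) → ZMod 2) = 2 ^ (k + 1) := by simp [ZMod.card]
  obtain ⟨H, hH⟩ := exists_card_le_two_mul_card_filter_zeroSumFree
    (V := Fin (k + 1) → ZMod 2) (F := F) fun S hS => by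
      rw [hcard]
      exact Nat.pow_le_pow_right two_pos (Nat.succ_le_succ (hF S hS))
  set F' := F.filter (ZeroSumFree H)
  obtain ⟨s, hs⟩ := exists_card_le_card_filter_eq_mul_card F' fun S => ∑ i ∈ S, H i
  refine ⟨F'.filter fun S => ∑ i ∈ S, H i = s,
    (Finset.filter_subset _ _).trans (Finset.filter_subset _ _),
    isCancellativePair_of_zeroSumFree (fun v => funext fun i => CharTwo.add_self_eq_zero (v i))
      (fun S hS => (Finset.mem_filter.1 (Finset.mem_filter.1 hS).1).2)
      (fun S hS => (Finset.mem_filter.1 hS).2), ?_⟩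
  rw [hcard] at hs
  rw [pow_succ]
  lia

end RandomLinear

section LowerBound

theorem exists_add_one_pow_le (x : ℝ) (n : ℕ) :
    ∃ k, (x + 1) ^ n ≤ (n + 1) * (x ^ k * n.choose k) := by
  obtain ⟨k, -, hk⟩ : ∃ k ∈ Finset.range (n + 1), (x + 1) ^ n / (n + 1) ≤
      x ^ k * n.choose k := by
    refine Finset.exists_le_of_sum_le ⟨0, by simp⟩ ?_
    rw [Finset.sum_const, Finset.card_range, nsmul_eq_mul, Nat.cast_succ,
      mul_div_cancel₀ _ (Nat.cast_add_one_ne_zero n), add_pow]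
    simp
  exact ⟨k, (div_le_iff₀' (by positivity)).1 hk⟩

theorem exists_isCancellativePair_three_halves_pow_le (n : ℕ) :
    ∃ F : Finset (Finset (Fin n)), IsCancellativePair F F ∧
      (3 / 2 : ℝ) ^ n ≤ 4 * (n + 1) * F.card := by
  obtain ⟨k, hk⟩ := exists_add_one_pow_le (1 / 2) n
  obtain ⟨F, -, hF, hcard⟩ := exists_isCancellativePair_subset
    (F := Finset.powersetCard k (Finset.univ : Finset (Fin n))) (k := k)
    fun S hS => (Finset.mem_powersetCard.1 hS).2.le
  rw [Finset.card_powersetCard, Finset.card_fin] at hcard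
  have hcard' : (n.choose k : ℝ) ≤ F.card * 2 ^ (k + 2) := by exact_mod_cast hcard
  refine ⟨F, hF, ?_⟩
  calc (3 / 2 : ℝ) ^ n = (1 / 2 + 1) ^ n := by norm_num
    _ ≤ (n + 1) * ((1 / 2) ^ k * n.choose k) := hk
    _ ≤ (n + 1) * ((1 / 2) ^ k * (F.card * 2 ^ (k + 2))) := by gcongr
    _ = 4 * (n + 1) * F.card * (1 / 2 * 2) ^ k := by rw [mul_pow]; ring
    _ = 4 * (n + 1) * F.card := by norm_num

theorem le_of_forall_pow_le_mul_pow {a b C : ℝ} {k : ℕ} (hb : 0 ≤ b)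
    (h : ∀ n : ℕ, n ≠ 0 → a ^ n ≤ C * (n ^ k * b ^ n)) : a ≤ b := by
  by_contra! hba
  have ha : 0 < a := hb.trans_lt hba
  have hlim := (tendsto_pow_const_mul_const_pow_of_abs_lt_one k (r := b / a) (by
    rwa [abs_of_nonneg (div_nonneg hb ha.le), div_lt_one ha])).const_mul C
  have hone : (1 : ℝ) ≤ C * 0 := by
    refine ge_of_tendsto hlim ?_
    filter_upwards [Filter.eventually_ne_atTop 0] with n hn
    rw [div_pow, ← mul_div_assoc, ← mul_div_assoc, one_le_div (pow_pos ha n)]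
    exact h n hn
  linarith

theorem nine_fourths_le_muCan : 9 / 4 ≤ muCan := by
  have hmuCan : 0 ≤ muCan :=
    ge_of_tendsto' tendsto_maxCan_and_maxCan_le_muCan.1 fun n => by
      obtain ⟨A, B, -, hmax⟩ := (isGreatest_maxCan n).1
      rw [hmax]
      positivity
  refine le_of_forall_pow_le_mul_pow (C := 64) (k := 2) hmuCan fun n hn => ?_
  obtain ⟨F, hF, hcard⟩ := exists_isCancellativePair_three_halves_pow_le n
  have hn' : (1 : ℝ) ≤ n := by exact_mod_cast Nat.one_le_iff_ne_zero.2 hn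
  calc (9 / 4 : ℝ) ^ n = ((3 / 2) ^ n) ^ 2 := by rw [← pow_mul, mul_comm, pow_mul]; norm_num
    _ ≤ (4 * (n + n) * F.card) ^ 2 := by
        refine pow_le_pow_left₀ (by positivity) (hcard.trans ?_) 2
        gcongr
    _ = 64 * (n ^ 2 * (F.card * F.card)) := by ring
    _ ≤ 64 * (n ^ 2 * muCan ^ n) := by gcongr; exact hF.card_mul_card_le hn

theorem maxRec_le {n : ℕ} (hn : n ≠ 0) : maxRec n ≤ 2.2499 := by
  obtain ⟨A, B, hAB, hmax⟩ := (isGreatest_maxRec n).1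
  refine le_of_pow_le_pow_left₀ hn (by norm_num) ?_
  rw [hmax, one_div, Real.rpow_inv_natCast_pow (by positivity) hn]
  simpa only [Fintype.card_fin] using hAB.card_mul_card_le

theorem muRec_le : muRec ≤ 2.2499 :=
  le_of_tendsto tendsto_maxRec <| by
    filter_upwards [Filter.eventually_ne_atTop 0] with n hn using maxRec_le hn

end LowerBound

theorem theorem1p3_general :
    Filter.Tendsto maxRec Filter.atTop (nhds muRec) ∧
    Filter.Tendsto maxCan Filter.atTop (nhds muCan) ∧
    (∀ (X : Type*) [Fintype X] [DecidableEq X] (A B : Finset (Finset X)),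
      IsRecoveringPair A B → (A.card : ℝ) * (B.card : ℝ) ≤ 2.2499 ^ Fintype.card X) ∧
    muRec ≤ 2.2499 ∧ 9 / 4 ≤ muCan :=
  ⟨tendsto_maxRec, tendsto_maxCan_and_maxCan_le_muCan.1, fun _ _ _ _ _ h => h.card_mul_card_le,
    muRec_le, nine_fourths_le_muCan⟩

theorem theorem1p3 :
    Filter.Tendsto maxRec Filter.atTop (nhds muRec) ∧
    Filter.Tendsto maxCan Filter.atTop (nhds muCan) ∧
    (∀ (n : ℕ) (X : Type*) [Fintype X] [DecidableEq X] (A B : Finset (Finset X)),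
      Fintype.card X = n → IsRecoveringPair A B →
      (A.card : ℝ) * (B.card : ℝ) ≤
        (max (2.2499 : ℝ) ((2.222 : ℝ) ^ (0.27 : ℝ) * muCan ^ (1 - 0.27 : ℝ))) ^ n) ∧
    muRec < muCan := by
  obtain ⟨hrec, hcan, hcard, hmuRec, hmuCan⟩ := theorem1p3_general
  refine ⟨hrec, hcan, ?_, hmuRec.trans_lt (lt_of_lt_of_le (by norm_num) hmuCan)⟩
  rintro _ X _ _ A B rfl hAB
  exact (hcard X A B hAB).trans (pow_le_pow_left₀ (by norm_num) (le_max_left _ _) _)
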